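/- Let $k$ be a perfect field, let $n$ be a natural number, and let $A$ be the algebra of upper triangular $n\times n$ matrices over $k$, with matrix units $E_{ij}$, $1\le i\le j\le n$. A filtration of a finite-dimensional associative $k$-algebra $A$ is a family $F_\bullet=(F_m)_{m\in\mathbb Z}$ of subspaces with $F_i\supseteq F_j$ for $i\le j$, $F_iF_j\subseteq F_{i+j}$ for all $i,j$, $F_m=A$ for $m\ll0$ and $F_m=0$ for $m\gg0$. It is trivial if $F_m=A$ for $m\le 0$ and $F_m=0$ for $m>0$. Put $$\operatorname{wt}(F_\bullet)=\sum_{m\in\mathbb Z} m\dim(F_m/F_{m+1}),\qquad \|F_\bullet\|=\Big(\sum_{m\in\mathbb Z} m^2\dim(F_m/F_{m+1})\Big)^{1/2},\qquad \nu(F_\bullet)=\frac{-\operatorname{wt}(F_\bullet)}{\|F_\bullet\|},$$ the last one for nontrivial $F_\bullet$. The algebra $A$ is semistable if $-\operatorname{wt}(F_\bullet)\ge 0$ for all filtrations $F_\bullet$ of $A$, and unstable otherwise. The canonical filtration of $A$ is the trivial filtration if $A$ is semistable. If $A$ is unstable, it is the filtration that minimizes $\nu$ among the nontrivial filtrations,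 unique up to scaling of the weights and normalized by indivisibility: $F_\bullet$ is canonical if it minimizes $\nu$ and every minimizer $G_\bullet$ is of the form $G_m=F_{\lceil m/c\rceil}$ $(m\in\mathbb Z)$ for some integer $c\ge1$. Then the canonical filtration of the algebra $A$ of upper triangular $n\times n$ matrices is the split filtration of the grading $A=\bigoplus_d A_d$ with $\deg E_{ij}=j-i$, that is, the filtration $$F_m=\bigoplus_{d\ge m}A_d,\qquad A_d=\operatorname{span}_k\{E_{ij} : i\le j,\ j-i=d\}.$$ -/

import Mathlib

/-- A filtration of a (not necessarily unital) associative algebra `A` over `k`: a decreasing,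
multiplicative family of subspaces `F m`, `m : ℤ`, equal to `A` for `m` small and to `0` for `m`
large. -/
structure AlgFiltration (k A : Type*) [Field k] [NonUnitalRing A] [Module k A] where
  F : ℤ → Submodule k A
  antitone : ∀ i j : ℤ, i ≤ j → F j ≤ F i
  mul_mem : ∀ (i j : ℤ) (x y : A), x ∈ F i → y ∈ F j → x * y ∈ F (i + j)
  eventually_top : ∃ N : ℤ, ∀ i : ℤ, i ≤ N → F i = ⊤
  eventually_bot : ∃ N : ℤ, ∀ i : ℤ, N ≤ i → F i = ⊥

namespace AlgFiltration

section

variable {k A : Type*} [Field k] [NonUnitalRing A] [Module k A]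

/-- The trivial filtration: `F m = A` for `m ≤ 0` and `F m = 0` for `m > 0`. -/
def trivial (k A : Type*) [Field k] [NonUnitalRing A] [Module k A] : AlgFiltration k A where
  F m := if m ≤ 0 then ⊤ else ⊥
  antitone i j hij := by
    by_cases hj : j ≤ 0
    · have hi : i ≤ 0 := hij.trans hj
      simp [hi]
    · simp [hj]
  mul_mem i j x y hx hy := by
    by_cases hi : i ≤ 0
    · by_cases hj : j ≤ 0
      · have hij : i + j ≤ 0 := by omega
        simp [hij]
      · have hy0 : y = 0 := by simpa [hj] using hy
        simp [hy0]
    · have hx0 : x = 0 := by simpa [hi] using hx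
      simp [hx0]
  eventually_top := ⟨0, fun i hi => by simp [hi]⟩
  eventually_bot := ⟨1, fun i hi => by
    have hi' : ¬ i ≤ 0 := by omega
    simp [hi']⟩

/-- The dimension over `k` of the graded piece `F m / F (m + 1)`. -/
noncomputable def grDim (G : AlgFiltration k A) (m : ℤ) : ℕ :=
  Module.finrank k (↥(G.F m) ⧸ (G.F (m + 1)).submoduleOf (G.F m))

/-- Only finitely many graded pieces are nonzero, so the sums over `ℤ` below are finite sums. -/
theorem grDim_support_finite (G : AlgFiltration k A) :
    (Function.support G.grDim).Finite := by
  obtain ⟨a, ha⟩ := G.eventually_top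
  obtain ⟨b, hb⟩ := G.eventually_bot
  refine (Set.finite_Icc a b).subset fun m hm => ?_
  by_contra hcon
  apply hm
  have key : G.F m ≤ G.F (m + 1) := by
    by_cases h1 : a ≤ m
    · have h2 : b ≤ m := by
        by_contra h
        exact hcon ⟨h1, by omega⟩
      rw [hb m h2]
      exact bot_le
    · rw [ha (m + 1) (by omega)]
      exact le_top
  have htop : (G.F (m + 1)).submoduleOf (G.F m) = ⊤ :=
    Submodule.submoduleOf_eq_top.mpr key
  unfold grDim
  rw [htop]
  have : Subsingleton (↥(G.F m) ⧸ (⊤ : Submodule k ↥(G.F m))) :=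
    Submodule.Quotient.subsingleton_iff.mpr rfl
  exact Module.finrank_zero_of_subsingleton

/-- The weight `∑ m, m * dim (F m / F (m + 1))`. -/
noncomputable def wt (G : AlgFiltration k A) : ℝ :=
  ∑ᶠ m : ℤ, (m : ℝ) * (G.grDim m : ℝ)

/-- The norm: the square root of `∑ m, m ^ 2 * dim (F m / F (m + 1))`. -/
noncomputable def norm (G : AlgFiltration k A) : ℝ :=
  Real.sqrt (∑ᶠ m : ℤ, (m : ℝ) ^ 2 * (G.grDim m : ℝ))

/-- The numerical invariant; it is used for nontrivial filtrations only, whose norm is nonzero. -/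
noncomputable def nu (G : AlgFiltration k A) : ℝ :=
  -G.wt / G.norm

/-- `G` is obtained from `H` by multiplying all weights by the positive integer `c`: an element
lies in `G m` if and only if `c` times its `H`-weight is at least `m`. -/
def IsMultiple (c : ℕ) (G H : AlgFiltration k A) : Prop :=
  ∀ m : ℤ, G.F m = H.F ⌈(m : ℚ) / (c : ℚ)⌉

/-- `G` minimizes the numerical invariant among the nontrivial filtrations of `A`. -/
def IsOptimal (G : AlgFiltration k A) : Prop :=
  G ≠ trivial k A ∧ ∀ H : AlgFiltration k A, H ≠ trivial k A → G.nu ≤ H.nu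

end

end AlgFiltration

/-- Semistability: `-wt ≥ 0` for all filtrations. -/
def IsSemistableAlg (k A : Type*) [Field k] [NonUnitalRing A] [Module k A] : Prop :=
  ∀ G : AlgFiltration k A, 0 ≤ -G.wt

/-- `G` is the canonical filtration of `A`. If `A` is semistable, this is the trivial filtration.
If `A` is unstable, it is the minimizer of the numerical invariant. The invariant does not change
when all weights are multiplied by the same positive integer, so "the" minimizer means: `G` is a
minimizer, and every minimizer is a positive integer multiple of `G`. -/
def IsCanonicalFiltration {k A : Type*} [Field k] [NonUnitalRing A] [Module k A]
    (G : AlgFiltration k A) : Prop :=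
  (IsSemistableAlg k A → G = AlgFiltration.trivial k A) ∧
  (¬ IsSemistableAlg k A →
    G.IsOptimal ∧
    ∀ H : AlgFiltration k A, H.IsOptimal → ∃ c : ℕ, 0 < c ∧ AlgFiltration.IsMultiple c H G)

/-- A `ℤ`-grading of the algebra `A`. -/
structure IsAlgGrading {k A : Type*} [Field k] [NonUnitalRing A] [Module k A]
    (𝒜 : ℤ → Submodule k A) : Prop where
  mul_mem : ∀ (i j : ℤ) (x y : A), x ∈ 𝒜 i → y ∈ 𝒜 j → x * y ∈ 𝒜 (i + j)
  isInternal : DirectSum.IsInternal 𝒜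

/-- The split filtration of a grading of a finite-dimensional algebra:
`F m` is the sum of the components of degree at least `m`. -/
def splitFiltration {k A : Type*} [Field k] [NonUnitalRing A] [Module k A]
    [IsScalarTower k A A] [SMulCommClass k A A] [FiniteDimensional k A]
    (𝒜 : ℤ → Submodule k A) (h𝒜 : IsAlgGrading 𝒜) : AlgFiltration k A where
  F m := ⨆ d : {d : ℤ // m ≤ d}, 𝒜 d
  antitone i j hij := iSup_le fun d =>
    le_iSup (fun e : {e : ℤ // i ≤ e} => 𝒜 e) ⟨d.1, hij.trans d.2⟩
  mul_mem i j x y hx hy := by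
    induction hx using Submodule.iSup_induction' with
    | zero => simp
    | add x₁ x₂ _ _ h₁ h₂ => rw [add_mul]; exact Submodule.add_mem _ h₁ h₂
    | mem d x hx =>
      induction hy using Submodule.iSup_induction' with
      | zero => simp
      | add y₁ y₂ _ _ h₁ h₂ => rw [mul_add]; exact Submodule.add_mem _ h₁ h₂
      | mem e y hy =>
        exact Submodule.mem_iSup_of_mem
          (p := fun f : {f : ℤ // i + j ≤ f} => 𝒜 f)
          ⟨d.1 + e.1, add_le_add d.2 e.2⟩ (h𝒜.mul_mem _ _ _ _ hx hy)
  eventually_top := by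
    have hfin : {d : ℤ | 𝒜 d ≠ ⊥}.Finite :=
      WellFoundedGT.finite_ne_bot_of_iSupIndep h𝒜.isInternal.submodule_iSupIndep
    obtain ⟨N, hN⟩ := hfin.bddBelow
    refine ⟨N, fun i hi => ?_⟩
    rw [eq_top_iff, ← h𝒜.isInternal.submodule_iSup_eq_top]
    refine iSup_le fun d => ?_
    by_cases hd : 𝒜 d = ⊥
    · rw [hd]; exact bot_le
    · exact le_iSup (fun e : {e : ℤ // i ≤ e} => 𝒜 e) ⟨d, hi.trans (hN hd)⟩
  eventually_bot := by
    have hfin : {d : ℤ | 𝒜 d ≠ ⊥}.Finite :=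
      WellFoundedGT.finite_ne_bot_of_iSupIndep h𝒜.isInternal.submodule_iSupIndep
    obtain ⟨N, hN⟩ := hfin.bddAbove
    refine ⟨N + 1, fun i hi => ?_⟩
    rw [eq_bot_iff]
    refine iSup_le fun d => ?_
    by_contra hd
    have h1 : 𝒜 d ≠ ⊥ := fun h => hd h.le
    have h2 : d.1 ≤ N := hN h1
    have h3 := d.2
    omega

/-- The algebra of upper triangular `n × n` matrices over `k`. -/
def upperTriangularAlg (k : Type*) [Field k] (n : ℕ) :
    Subalgebra k (Matrix (Fin n) (Fin n) k) where
  carrier := {M | M.IsUpperTriangular}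
  mul_mem' hM hN := Matrix.BlockTriangular.mul hM hN
  add_mem' hM hN := Matrix.BlockTriangular.add hM hN
  algebraMap_mem' r := by
    intro i j hij
    have hne : i ≠ j := (ne_of_lt hij).symm
    simp [Matrix.algebraMap_matrix_apply, hne]

/-- The degree `d` component of the grading `deg E_{ij} = j - i` of the algebra of upper triangular
matrices: the span of the matrix units `E_{ij}` with `i ≤ j` and `j - i = d`. -/
def matrixUnitGrading (k : Type*) [Field k] (n : ℕ) (d : ℤ) :
    Submodule k (upperTriangularAlg k n) :=
  Submodule.span k {x | ∃ i j : Fin n, i ≤ j ∧ ((j : ℕ) : ℤ) - ((i : ℕ) : ℤ) = d ∧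
    (x : Matrix (Fin n) (Fin n) k) = Matrix.single i j 1}

theorem mem_matrixUnitGrading_iff {k : Type*} [Field k] {n : ℕ} {d : ℤ}
    {x : upperTriangularAlg k n} :
    x ∈ matrixUnitGrading k n d ↔ ∀ i j : Fin n, ((j : ℕ) : ℤ) - ((i : ℕ) : ℤ) ≠ d →
      (x : Matrix (Fin n) (Fin n) k) i j = 0 := by
  constructor
  · intro hx
    induction hx using Submodule.span_induction with
    | mem x hx =>
      obtain ⟨a, b, _, hd, hx⟩ := hx
      intro i j hij
      rw [hx, Matrix.single_apply, if_neg]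
      rintro ⟨rfl, rfl⟩
      exact hij hd
    | zero => intro i j _; simp
    | add x y _ _ hx hy => intro i j hij; simp [hx i j hij, hy i j hij]
    | smul c x _ hx => intro i j hij; simp [hx i j hij]
  · intro h
    have hE : ∀ p : Fin n × Fin n, p.1 ≤ p.2 →
        Matrix.single p.1 p.2 (1 : k) ∈ upperTriangularAlg k n := by
      intro p hp i j hij
      rw [Matrix.single_apply, if_neg]
      rintro ⟨h1, h2⟩
      rw [h1, h2] at hp
      exact absurd hij (not_lt.mpr hp)
    have hsum : x = ∑ p : Fin n × Fin n, if hp : p.1 ≤ p.2 then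
        (x : Matrix (Fin n) (Fin n) k) p.1 p.2 •
          (⟨Matrix.single p.1 p.2 1, hE p hp⟩ : upperTriangularAlg k n) else 0 := by
      apply Subtype.ext
      conv_lhs => rw [Matrix.matrix_eq_sum_single (x : Matrix (Fin n) (Fin n) k)]
      rw [← Fintype.sum_prod_type', AddSubmonoidClass.coe_finsetSum]
      refine Finset.sum_congr rfl fun p _ => ?_
      split_ifs with hp
      · simp [Matrix.smul_single]
      · have : (x : Matrix (Fin n) (Fin n) k) p.1 p.2 = 0 := x.2 (not_le.mp hp)
        simp [this]
    rw [hsum]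
    refine Submodule.sum_mem _ fun p _ => ?_
    split_ifs with hp
    · by_cases hd : ((p.2 : ℕ) : ℤ) - ((p.1 : ℕ) : ℤ) = d
      · exact Submodule.smul_mem _ _ (Submodule.subset_span ⟨p.1, p.2, hp, hd, rfl⟩)
      · rw [h _ _ hd, zero_smul]
        exact Submodule.zero_mem _
    · exact Submodule.zero_mem _

theorem matrixUnitGrading_isAlgGrading (k : Type*) [Field k] (n : ℕ) :
    IsAlgGrading (matrixUnitGrading k n) where
  mul_mem a b x y hx hy := by
    rw [mem_matrixUnitGrading_iff] at hx hy ⊢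
    intro i j hij
    rw [MulMemClass.coe_mul, Matrix.mul_apply]
    refine Finset.sum_eq_zero fun l _ => ?_
    by_cases h1 : ((l : ℕ) : ℤ) - ((i : ℕ) : ℤ) = a
    · have h2 : ((j : ℕ) : ℤ) - ((l : ℕ) : ℤ) ≠ b := by omega
      rw [hy l j h2, mul_zero]
    · rw [hx i l h1, zero_mul]
  isInternal := by
    apply DirectSum.isInternal_submodule_of_iSupIndep_of_iSup_eq_top
    · intro d
      rw [Submodule.disjoint_def]
      intro x hx hx'
      have hle : (⨆ e, ⨆ _ : e ≠ d, matrixUnitGrading k n e) ≤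
          ({ carrier := {x | ∀ i j : Fin n, ((j : ℕ) : ℤ) - ((i : ℕ) : ℤ) = d →
                (x : Matrix (Fin n) (Fin n) k) i j = 0}
             add_mem' := fun {x y} hx hy i j hij => by simp [hx i j hij, hy i j hij]
             zero_mem' := fun i j _ => by simp
             smul_mem' := fun c x hx i j hij => by simp [hx i j hij] } :
            Submodule k (upperTriangularAlg k n)) := by
        refine iSup_le fun e => iSup_le fun he y hy i j hij => ?_
        exact mem_matrixUnitGrading_iff.mp hy i j (by omega)
      have h0 := hle hx'
      rw [mem_matrixUnitGrading_iff] at hx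
      apply Subtype.ext
      ext i j
      by_cases hij : ((j : ℕ) : ℤ) - ((i : ℕ) : ℤ) = d
      · exact h0 i j hij
      · exact hx i j hij
    · rw [eq_top_iff]
      have hall : ∀ x : upperTriangularAlg k n, ∀ i j : Fin n, ∀ hE :
          Matrix.single i j ((x : Matrix (Fin n) (Fin n) k) i j) ∈ upperTriangularAlg k n,
          (⟨_, hE⟩ : upperTriangularAlg k n) ∈ ⨆ d, matrixUnitGrading k n d := by
        intro x i j hE
        refine Submodule.mem_iSup_of_mem (((j : ℕ) : ℤ) - ((i : ℕ) : ℤ)) ?_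
        rw [mem_matrixUnitGrading_iff]
        intro a b hab
        show Matrix.single i j _ a b = 0
        rw [Matrix.single_apply, if_neg]
        rintro ⟨rfl, rfl⟩
        exact hab rfl
      intro x _
      have hE : ∀ p : Fin n × Fin n, Matrix.single p.1 p.2
          ((x : Matrix (Fin n) (Fin n) k) p.1 p.2) ∈ upperTriangularAlg k n := by
        intro p a b hab
        rw [Matrix.single_apply]
        split_ifs with h
        · rw [h.1, h.2]; exact x.2 hab
        · rfl
      have hsum : x = ∑ p : Fin n × Fin n, (⟨_, hE p⟩ : upperTriangularAlg k n) := by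
        apply Subtype.ext
        conv_lhs => rw [Matrix.matrix_eq_sum_single (x : Matrix (Fin n) (Fin n) k)]
        rw [← Fintype.sum_prod_type', AddSubmonoidClass.coe_finsetSum]
      rw [hsum]
      exact Submodule.sum_mem _ fun p _ => hall x p.1 p.2 (hE p)

/-! Order the positions (i, j), i ≤ j, by degree j - i and then by row. Giving each position p the
largest m for which p is a leading position of F m yields integers w p. Dimensions are counted by
leading positions, so wt = ∑ w p and norm² = ∑ (w p)² (`IsLeadingWeight.wt_eq`,
`IsLeadingWeight.norm_eq`). Multiplicativity gives w ij + w jl ≤ w il (`weight_add_le`), and w ii ≤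
0 because powers of a matrix in positive weight eventually vanish (`weight_diag_nonpos`). Summing
the first over all i < j < l and adding n times the second gives n ∑ w ≤ 2 ∑ deg · w, with equality
for w = deg. Cauchy–Schwarz bounds the right side by 2 ‖deg‖ ‖w‖, so deg minimizes `nu`. Equality
forces w = c · deg (`nu_degFiltration_le`), and such weights determine the filtration
(`isMultiple_of_weight_eq`). -/

/-! ### Dimension of a subspace through leading positions -/

namespace Submodule

variable {k A P ι : Type*} [Field k] [AddCommGroup A] [Module k A] [LinearOrder ι]

/-- The leading positions of the nonzero elements of a subspace `W`: coordinates are given by `φ`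
and ordered by the key `κ`, and the leading position is the nonzero one of least key. -/
def leadingPositions (φ : A →ₗ[k] P → k) (κ : P → ι) (W : Submodule k A) : Set P :=
  {p | ∃ x ∈ W, φ x p ≠ 0 ∧ ∀ q, κ q < κ p → φ x q = 0}

theorem leadingPositions_mono (φ : A →ₗ[k] P → k) (κ : P → ι) {V W : Submodule k A}
    (h : V ≤ W) : V.leadingPositions φ κ ⊆ W.leadingPositions φ κ :=
  fun _ ⟨x, hx, h'⟩ => ⟨x, h hx, h'⟩

theorem exists_leading_position [Finite P] {φ : A →ₗ[k] P → k} (hφ : Function.Injective φ)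
    (κ : P → ι) {x : A} (hx : x ≠ 0) : ∃ p, φ x p ≠ 0 ∧ ∀ q, κ q < κ p → φ x q = 0 := by
  have hne : {p | φ x p ≠ 0}.Nonempty := by
    by_contra h
    rw [Set.not_nonempty_iff_eq_empty] at h
    refine hx (hφ ?_)
    ext p
    by_contra hp
    have : p ∈ {p | φ x p ≠ 0} := by simpa using hp
    simp [h] at this
  obtain ⟨p, hp, hmin⟩ := Set.exists_min_image _ κ (Set.toFinite _) hne
  refine ⟨p, hp, fun q hq => ?_⟩
  by_contra h
  exact absurd (hmin q h) (not_le.mpr hq)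

/-- Echelon form. Restriction to the leading positions is injective on W, since a nonzero element
survives at its own leading position. Conversely, one element chosen per leading position gives a
triangular matrix with nonzero diagonal. -/
theorem finrank_eq_ncard_leadingPositions [Fintype P] {φ : A →ₗ[k] P → k}
    (hφ : Function.Injective φ) {κ : P → ι} (hκ : Function.Injective κ) (W : Submodule k A) :
    Module.finrank k W = (W.leadingPositions φ κ).ncard := by
  classical
  have hA : FiniteDimensional k A := FiniteDimensional.of_injective φ hφ
  rw [← Nat.card_coe_set_eq, Nat.card_eq_fintype_card]
  apply le_antisymm
  · let ψ : W →ₗ[k] (W.leadingPositions φ κ → k) :=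
      (LinearMap.funLeft k k Subtype.val) ∘ₗ φ ∘ₗ W.subtype
    have hψ : Function.Injective ψ := by
      rw [← LinearMap.ker_eq_bot, LinearMap.ker_eq_bot']
      intro x hx
      by_contra hne
      obtain ⟨p, hp, hmin⟩ := exists_leading_position hφ κ
        (x := (x : A)) (fun h => hne (Subtype.ext h))
      exact hp (congrFun hx ⟨p, x, x.2, hp, hmin⟩)
    simpa using LinearMap.finrank_le_finrank_of_injective hψ
  · choose x hxW hx hx0 using fun p : W.leadingPositions φ κ => p.2
    let _ : LinearOrder (W.leadingPositions φ κ) :=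
      LinearOrder.lift' (fun p => κ p.1) (hκ.comp Subtype.val_injective)
    let M : Matrix (W.leadingPositions φ κ) (W.leadingPositions φ κ) k :=
      Matrix.of fun p q => φ (x p) q
    have hM : M.IsUpperTriangular := fun p q hqp => hx0 p q hqp
    have hdet : M.det ≠ 0 := by
      rw [Matrix.det_of_isUpperTriangular hM]
      exact Finset.prod_ne_zero_iff.mpr fun p _ => hx p
    have hrows : LinearIndependent k M.row :=
      Matrix.linearIndependent_rows_of_det_ne_zero hdet
    have hind : LinearIndependent k (fun p => (⟨x p, hxW p⟩ : W)) :=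
      LinearIndependent.of_comp
        ((LinearMap.funLeft k k Subtype.val) ∘ₗ φ ∘ₗ W.subtype) hrows
    exact hind.fintype_card_le_finrank

end Submodule

/-! ### Weight and norm as sums over positions -/

namespace AlgFiltration

variable {k A P ι : Type*} [Field k] [NonUnitalRing A] [Module k A] [LinearOrder ι]

theorem ext_F {G H : AlgFiltration k A} (h : ∀ m, G.F m = H.F m) : G = H := by
  cases G; cases H; congr; exact funext h

/-- `w p` is the largest `m` such that `p` is a leading position of `G.F m`. -/
def IsLeadingWeight (φ : A →ₗ[k] P → k) (κ : P → ι) (G : AlgFiltration k A) (w : P → ℤ) : Prop :=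
  ∀ p m, p ∈ (G.F m).leadingPositions φ κ ↔ m ≤ w p

/-- For fixed p the admissible m form a down-closed set. It is nonempty because every position leads
in the whole algebra, and bounded above because the filtration ends in 0. -/
theorem exists_isLeadingWeight [Fintype P] {φ : A →ₗ[k] P → k} (hφ : Function.Surjective φ)
    (κ : P → ι) (G : AlgFiltration k A) : ∃ w, G.IsLeadingWeight φ κ w := by
  classical
  suffices h : ∀ p, ∃ b, ∀ m, p ∈ (G.F m).leadingPositions φ κ ↔ m ≤ b by
    choose w hw using h
    exact ⟨w, hw⟩
  intro p
  obtain ⟨a, ha⟩ := G.eventually_top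
  obtain ⟨b, hb⟩ := G.eventually_bot
  have hlow : p ∈ (G.F a).leadingPositions φ κ := by
    obtain ⟨x, hx⟩ := hφ (Pi.single p 1)
    refine ⟨x, by simp [ha a le_rfl], by simp [hx], fun q hq => ?_⟩
    have : q ≠ p := by rintro rfl; exact lt_irrefl _ hq
    simp [hx, this]
  obtain ⟨c, hc, hmax⟩ := Int.exists_greatest_of_bdd
    (P := fun m => p ∈ (G.F m).leadingPositions φ κ)
    ⟨b, fun m ⟨x, hx, hne, _⟩ => by
      by_contra hm
      rw [hb m (by omega), Submodule.mem_bot] at hx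
      simp [hx] at hne⟩ ⟨a, hlow⟩
  exact ⟨c, fun m => ⟨hmax m, fun h =>
    Submodule.leadingPositions_mono φ κ (G.antitone _ _ h) hc⟩⟩

namespace IsLeadingWeight

variable [Fintype P] {φ : A →ₗ[k] P → k} {κ : P → ι} {G : AlgFiltration k A} {w : P → ℤ}

theorem finrank_eq (hφ : Function.Injective φ) (hκ : Function.Injective κ)
    (hw : G.IsLeadingWeight φ κ w) (m : ℤ) :
    Module.finrank k (G.F m) = (Finset.univ.filter fun p => m ≤ w p).card := by
  rw [Submodule.finrank_eq_ncard_leadingPositions hφ hκ, ← Set.ncard_coe_finset]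
  congr 1
  ext p
  simp [hw p m]

theorem grDim_eq (hφ : Function.Injective φ) (hκ : Function.Injective κ)
    (hw : G.IsLeadingWeight φ κ w) (m : ℤ) :
    G.grDim m = (Finset.univ.filter fun p => w p = m).card := by
  have hA : FiniteDimensional k A := FiniteDimensional.of_injective φ hφ
  have h1 := Submodule.finrank_quotient_add_finrank ((G.F (m + 1)).submoduleOf (G.F m))
  rw [(Submodule.submoduleOfEquivOfLe (G.antitone m (m + 1) (by omega))).finrank_eq,
    hw.finrank_eq hφ hκ, hw.finrank_eq hφ hκ] at h1
  have h2 : (Finset.univ.filter fun p => m ≤ w p).card =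
      (Finset.univ.filter fun p => w p = m).card +
        (Finset.univ.filter fun p => m + 1 ≤ w p).card := by
    classical
    rw [← Finset.card_union_of_disjoint]
    · congr 1
      ext p
      simp
      omega
    · rw [Finset.disjoint_filter]
      intro p _
      omega
  unfold grDim
  omega

/-- Each m occurs exactly `grDim m` times among the values of w, so the sum over m is a sum over
positions grouped by weight. -/
theorem finsum_grDim (hφ : Function.Injective φ) (hκ : Function.Injective κ)
    (hw : G.IsLeadingWeight φ κ w) (f : ℤ → ℝ) :
    ∑ᶠ m : ℤ, f m * (G.grDim m : ℝ) = ∑ p, f (w p) := by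
  classical
  rw [finsum_eq_sum_of_support_subset (s := Finset.univ.image w)]
  · rw [← Finset.sum_fiberwise_of_maps_to (s := Finset.univ) (t := Finset.univ.image w) (g := w)
      (fun p _ => Finset.mem_image_of_mem _ (Finset.mem_univ p))]
    refine Finset.sum_congr rfl fun m _ => ?_
    rw [hw.grDim_eq hφ hκ, Finset.sum_congr rfl
      (fun p hp => by rw [(Finset.mem_filter.mp hp).2] : ∀ p ∈ Finset.univ.filter
        (fun p => w p = m), f (w p) = f m), Finset.sum_const, nsmul_eq_mul, mul_comm]
  · intro m hm
    by_contra h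
    apply hm
    have : (Finset.univ.filter fun p => w p = m) = ∅ := by
      ext p
      simp only [Finset.mem_filter, Finset.mem_univ, true_and, Finset.notMem_empty, iff_false]
      rintro rfl
      exact h (by simp)
    simp [hw.grDim_eq hφ hκ, this]

theorem wt_eq (hφ : Function.Injective φ) (hκ : Function.Injective κ)
    (hw : G.IsLeadingWeight φ κ w) : G.wt = ∑ p, (w p : ℝ) :=
  hw.finsum_grDim hφ hκ (fun m => (m : ℝ))

theorem norm_eq (hφ : Function.Injective φ) (hκ : Function.Injective κ)
    (hw : G.IsLeadingWeight φ κ w) : G.norm = Real.sqrt (∑ p, (w p : ℝ) ^ 2) :=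
  congrArg Real.sqrt (hw.finsum_grDim hφ hκ (fun m => (m : ℝ) ^ 2))

end IsLeadingWeight

end AlgFiltration

/-! ### Coordinates and the degree filtration -/

namespace UpperTriangular

open AlgFiltration

/-- The positions on or above the diagonal. -/
abbrev Position (n : ℕ) : Type := {p : Fin n × Fin n // p.1 ≤ p.2}

/-- The degree `j - i` of the position `(i, j)`. -/
def Position.deg {n : ℕ} (p : Position n) : ℤ := ((p.1.2 : ℕ) : ℤ) - ((p.1.1 : ℕ) : ℤ)

/-- Positions are ordered by degree, and within one degree by row. -/
def Position.key {n : ℕ} (p : Position n) : ℤ ×ₗ ℕ := toLex (p.deg, (p.1.1 : ℕ))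

theorem Position.key_lt_iff {n : ℕ} {p q : Position n} : p.key < q.key ↔
    p.deg < q.deg ∨ p.deg = q.deg ∧ (p.1.1 : ℕ) < q.1.1 := by
  simp [Position.key, Prod.Lex.lt_iff]

theorem Position.key_injective (n : ℕ) : Function.Injective (Position.key (n := n)) := by
  intro p q h
  have h' : (p.deg, (p.1.1 : ℕ)) = (q.deg, (q.1.1 : ℕ)) := h
  simp only [Prod.mk.injEq, Position.deg] at h'
  obtain ⟨h1, h2⟩ := h'
  exact Subtype.ext (Prod.ext (Fin.ext h2) (Fin.ext (by omega)))

variable (k : Type*) [Field k] (n : ℕ)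

/-- The entries on and above the diagonal. -/
def coords : upperTriangularAlg k n →ₗ[k] Position n → k where
  toFun x p := (x : Matrix (Fin n) (Fin n) k) p.1.1 p.1.2
  map_add' _ _ := rfl
  map_smul' _ _ := rfl

theorem coords_apply (x : upperTriangularAlg k n) (p : Position n) :
    coords k n x p = (x : Matrix (Fin n) (Fin n) k) p.1.1 p.1.2 := rfl

theorem coords_injective : Function.Injective (coords k n) := by
  intro x y h
  apply Subtype.ext
  ext i j
  by_cases hij : i ≤ j
  · exact congrFun h ⟨(i, j), hij⟩
  · rw [x.2 (not_le.mp hij), y.2 (not_le.mp hij)]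

theorem coords_surjective : Function.Surjective (coords k n) := by
  intro f
  refine ⟨⟨fun i j => if h : i ≤ j then f ⟨(i, j), h⟩ else 0, fun i j hij => ?_⟩, ?_⟩
  · exact dif_neg (not_le.mpr hij)
  · ext p
    exact dif_pos p.2

/-- The filtration by the distance from the diagonal. -/
noncomputable abbrev degFiltration : AlgFiltration k (upperTriangularAlg k n) :=
  splitFiltration (matrixUnitGrading k n) (matrixUnitGrading_isAlgGrading k n)

variable {k n}

theorem mem_degFiltration_iff {m : ℤ} {x : upperTriangularAlg k n} :
    x ∈ (degFiltration k n).F m ↔ ∀ p : Position n, p.deg < m → coords k n x p = 0 := by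
  constructor
  · intro hx p hp
    change x ∈ ⨆ d : {d : ℤ // m ≤ d}, matrixUnitGrading k n d at hx
    induction hx using Submodule.iSup_induction' with
    | zero => simp
    | add y z _ _ hy hz => simp [hy, hz]
    | mem d y hy =>
      refine mem_matrixUnitGrading_iff.mp hy p.1.1 p.1.2 ?_
      have := d.2
      unfold Position.deg at hp
      omega
  · intro h
    have hmem : ∀ p : Position n, Matrix.single p.1.1 p.1.2 (1 : k) ∈ upperTriangularAlg k n := by
      intro p a b hab
      rw [Matrix.single_apply, if_neg]
      rintro ⟨h1, h2⟩
      have := p.2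
      rw [h1, h2] at this
      exact absurd hab (not_lt.mpr this)
    have hsum : x = ∑ p : Position n, coords k n x p •
        (⟨Matrix.single p.1.1 p.1.2 1, hmem p⟩ : upperTriangularAlg k n) := by
      apply coords_injective
      ext q
      rw [map_sum, Finset.sum_apply, Finset.sum_eq_single q]
      · simp [coords_apply]
      · intro p _ hpq
        have : ¬ (p.1.1 = q.1.1 ∧ p.1.2 = q.1.2) :=
          fun h => hpq (Subtype.ext (Prod.ext h.1 h.2))
        simp [coords_apply, this]
      · simp
    rw [hsum]
    refine Submodule.sum_mem _ fun p _ => ?_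
    by_cases hp : p.deg < m
    · rw [h p hp, zero_smul]
      exact Submodule.zero_mem _
    · exact Submodule.smul_mem _ _ (Submodule.mem_iSup_of_mem
        (p := fun d : {d : ℤ // m ≤ d} => matrixUnitGrading k n d) ⟨p.deg, not_lt.mp hp⟩
        (Submodule.subset_span ⟨p.1.1, p.1.2, p.2, rfl, rfl⟩))

theorem isLeadingWeight_degFiltration :
    (degFiltration k n).IsLeadingWeight (coords k n) Position.key Position.deg := by
  intro p m
  constructor
  · rintro ⟨x, hx, hne, _⟩
    by_contra h
    exact hne (mem_degFiltration_iff.mp hx p (not_le.mp h))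
  · intro h
    obtain ⟨x, hx⟩ := coords_surjective k n (Pi.single p 1)
    refine ⟨x, mem_degFiltration_iff.mpr fun q hq => ?_, by simp [hx], fun q hq => ?_⟩
    · have : q ≠ p := by rintro rfl; omega
      simp [hx, this]
    · have : q ≠ p := by rintro rfl; exact lt_irrefl _ hq
      simp [hx, this]

/-! ### Constraints on the leading weights -/

section Weights

variable {G : AlgFiltration k (upperTriangularAlg k n)} {w : Position n → ℤ}

/-- The exponent starts at 1 because the unit need not lie in F 0. -/
theorem pow_mem_F (x : upperTriangularAlg k n) {m : ℤ} (hx : x ∈ G.F m) (N : ℕ) :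
    x ^ (N + 1) ∈ G.F ((N + 1 : ℕ) * m) := by
  induction N with
  | zero => simpa using hx
  | succ N ih =>
    rw [pow_succ]
    have := G.mul_mem _ _ _ _ ih hx
    convert this using 2
    push_cast
    ring

theorem diag_pow (x : upperTriangularAlg k n) (i : Fin n) (N : ℕ) :
    ((x ^ N : upperTriangularAlg k n) : Matrix (Fin n) (Fin n) k) i i =
      (x : Matrix (Fin n) (Fin n) k) i i ^ N := by
  induction N with
  | zero => simp
  | succ N ih =>
    rw [pow_succ, MulMemClass.coe_mul, Matrix.mul_apply, Finset.sum_eq_single i, ih, pow_succ]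
    · intro j _ hj
      rcases lt_or_gt_of_ne hj with h | h
      · rw [(x ^ N).2 h, zero_mul]
      · rw [x.2 h, mul_zero]
    · simp

/-- An element of positive weight is nilpotent, while diagonal entries of triangular matrices are
multiplicative, so its diagonal vanishes. -/
theorem weight_diag_nonpos (hw : G.IsLeadingWeight (coords k n) Position.key w)
    (p : Position n) (hp : p.1.1 = p.1.2) : w p ≤ 0 := by
  by_contra hpos
  obtain ⟨x, hx, hne, _⟩ := (hw p (w p)).mpr le_rfl
  obtain ⟨b, hb⟩ := G.eventually_bot
  have h1 := pow_mem_F x hx b.toNat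
  rw [hb, Submodule.mem_bot] at h1
  · have h2 := diag_pow x p.1.1 (b.toNat + 1)
    rw [h1] at h2
    have h3 : (x : Matrix (Fin n) (Fin n) k) p.1.1 p.1.1 = 0 :=
      pow_eq_zero_iff (Nat.succ_ne_zero _) |>.mp h2.symm
    apply hne
    change (x : Matrix (Fin n) (Fin n) k) p.1.1 p.1.2 = 0
    rw [← hp, h3]
  · have h4 : b ≤ b.toNat := Int.self_le_toNat b
    push_cast
    nlinarith

/-- The order is compatible with products: if x leads at (i, j) and y at (j, l), then x * y leads at
(i, l). -/
theorem weight_add_le (hw : G.IsLeadingWeight (coords k n) Position.key w)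
    {i j l : Fin n} (hij : i ≤ j) (hjl : j ≤ l) :
    w ⟨(i, j), hij⟩ + w ⟨(j, l), hjl⟩ ≤ w ⟨(i, l), hij.trans hjl⟩ := by
  obtain ⟨x, hx, hxne, hx0⟩ := (hw ⟨(i, j), hij⟩ _).mpr le_rfl
  obtain ⟨y, hy, hyne, hy0⟩ := (hw ⟨(j, l), hjl⟩ _).mpr le_rfl
  have hx0' : ∀ a b : Fin n, ((b : ℤ) - a < (j : ℤ) - i ∨
      (b : ℤ) - a = (j : ℤ) - i ∧ (a : ℕ) < i) → (x : Matrix (Fin n) (Fin n) k) a b = 0 := by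
    intro a b h
    by_cases hab : a ≤ b
    · exact hx0 ⟨(a, b), hab⟩ (Position.key_lt_iff.mpr h)
    · exact x.2 (not_le.mp hab)
  have hy0' : ∀ a b : Fin n, ((b : ℤ) - a < (l : ℤ) - j ∨
      (b : ℤ) - a = (l : ℤ) - j ∧ (a : ℕ) < j) → (y : Matrix (Fin n) (Fin n) k) a b = 0 := by
    intro a b h
    by_cases hab : a ≤ b
    · exact hy0 ⟨(a, b), hab⟩ (Position.key_lt_iff.mpr h)
    · exact y.2 (not_le.mp hab)
  rw [← hw]
  refine ⟨x * y, G.mul_mem _ _ _ _ hx hy, ?_, fun q hq => ?_⟩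
  · change (x * y : Matrix (Fin n) (Fin n) k) i l ≠ 0
    rw [Matrix.mul_apply, Finset.sum_eq_single j]
    · exact mul_ne_zero hxne hyne
    · intro c _ hc
      have hc' : (c : ℕ) ≠ j := fun h => hc (Fin.ext h)
      -- Only c = j contributes: on either side of j one factor has degree below its leading degree.
      by_cases h : (c : ℤ) < j
      · rw [hx0' i c (by omega), zero_mul]
      · rw [hy0' c l (by omega), mul_zero]
    · simp
  · change (x * y : Matrix (Fin n) (Fin n) k) q.1.1 q.1.2 = 0
    rw [Matrix.mul_apply]
    refine Finset.sum_eq_zero fun c _ => ?_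
    rw [Position.key_lt_iff] at hq
    simp only [Position.deg] at hq
    -- If the left factor is not below its leading position, the degree left for the right factor is
    -- too small. The row tie-break excludes equality in both degrees.
    by_cases h : (c : ℤ) - (q.1.1 : ℕ) < (j : ℤ) - i ∨
        (c : ℤ) - (q.1.1 : ℕ) = (j : ℤ) - i ∧ (q.1.1 : ℕ) < i
    · rw [hx0' _ c h, zero_mul]
    · rw [hy0' c _ (by omega), mul_zero]

end Weights

/-! ### The summed inequality -/

section Sums

/-- For i < j, W i j occurs n - 1 - j times as first term, i times as second and, negatively, j - i
- 1 times as third; the total is n - 2(j - i). -/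
theorem sum_triples (W : Fin n → Fin n → ℤ) :
    ∑ i, ∑ j, ∑ l, (if i < j ∧ j < l then W i j + W j l - W i l else 0) =
      ∑ i : Fin n, ∑ j : Fin n, if i < j then ((n : ℤ) - 2 * ((j : ℤ) - i)) * W i j else 0 := by
  have e1 : ∀ i j : Fin n, ∑ l, (if i < j ∧ j < l then W i j else 0) =
      if i < j then ((n : ℤ) - 1 - j) * W i j else 0 := by
    intro i j
    split_ifs with h
    · have hc : (Finset.univ.filter fun l : Fin n => j < l).card = n - 1 - j := by
        rw [← Fin.card_Ioi]; congr 1; ext; simp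
      simp only [h, true_and]
      rw [← Finset.sum_filter, Finset.sum_const, hc, nsmul_eq_mul]
      congr 1
      have := j.2
      omega
    · simp [h]
  have e2 : ∀ j l : Fin n, ∑ i, (if i < j ∧ j < l then W j l else 0) =
      if j < l then (j : ℤ) * W j l else 0 := by
    intro j l
    split_ifs with h
    · have hc : (Finset.univ.filter fun i : Fin n => i < j).card = j := by
        rw [← Fin.card_Iio]; congr 1; ext; simp
      simp only [h, and_true]
      rw [← Finset.sum_filter, Finset.sum_const, hc, nsmul_eq_mul]
    · simp [h]
  have e3 : ∀ i l : Fin n, ∑ j, (if i < j ∧ j < l then W i l else 0) =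
      if i < l then ((l : ℤ) - i - 1) * W i l else 0 := by
    intro i l
    split_ifs with h
    · have hc : (Finset.univ.filter fun j : Fin n => i < j ∧ j < l).card = l - i - 1 := by
        rw [← Fin.card_Ioo]; congr 1; ext; simp
      rw [← Finset.sum_filter, Finset.sum_const, hc, nsmul_eq_mul]
      congr 1
      have : (i : ℕ) < l := h
      omega
    · refine Finset.sum_eq_zero fun j _ => if_neg fun hj => h (hj.1.trans hj.2)
  have split : ∀ i j l : Fin n, (if i < j ∧ j < l then W i j + W j l - W i l else 0) =
      (if i < j ∧ j < l then W i j else 0) + (if i < j ∧ j < l then W j l else 0) -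
        (if i < j ∧ j < l then W i l else 0) := by
    intro i j l
    split_ifs <;> simp
  simp only [split, Finset.sum_add_distrib, Finset.sum_sub_distrib]
  have s2 : ∑ i, ∑ j, ∑ l, (if i < j ∧ j < l then W j l else 0) =
      ∑ j : Fin n, ∑ l : Fin n, if j < l then (j : ℤ) * W j l else 0 := by
    rw [Finset.sum_comm]
    refine Finset.sum_congr rfl fun j _ => ?_
    rw [Finset.sum_comm]
    exact Finset.sum_congr rfl fun l _ => e2 j l
  have s3 : ∑ i, ∑ j, ∑ l, (if i < j ∧ j < l then W i l else 0) =
      ∑ i : Fin n, ∑ l : Fin n, if i < l then ((l : ℤ) - i - 1) * W i l else 0 := by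
    refine Finset.sum_congr rfl fun i _ => ?_
    rw [Finset.sum_comm]
    exact Finset.sum_congr rfl fun l _ => e3 i l
  rw [s2, s3]
  simp only [e1]
  rw [← Finset.sum_add_distrib, ← Finset.sum_sub_distrib]
  refine Finset.sum_congr rfl fun i _ => ?_
  rw [← Finset.sum_add_distrib, ← Finset.sum_sub_distrib]
  refine Finset.sum_congr rfl fun j _ => ?_
  split_ifs
  · ring
  · simp

theorem sum_position_eq (f : Position n → ℤ) :
    ∑ p, f p = (∑ i : Fin n, f ⟨(i, i), le_rfl⟩) +
      ∑ i, ∑ j, if h : i < j then f ⟨(i, j), h.le⟩ else 0 := by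
  have h1 : ∑ p, f p = ∑ i, ∑ j, if h : i ≤ j then f ⟨(i, j), h⟩ else 0 := by
    rw [← Fintype.sum_prod_type' (f := fun i j => if h : i ≤ j then f ⟨(i, j), h⟩ else 0)]
    rw [← Fintype.sum_subtype_add_sum_subtype (fun p : Fin n × Fin n => p.1 ≤ p.2),
      Finset.sum_eq_zero (s := (Finset.univ : Finset {p : Fin n × Fin n // ¬ p.1 ≤ p.2}))
        (fun p _ => dif_neg p.2), add_zero]
    exact Finset.sum_congr rfl fun p _ => by rw [dif_pos p.2]
  rw [h1, ← Finset.sum_add_distrib]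
  refine Finset.sum_congr rfl fun i _ => ?_
  have h2 : f ⟨(i, i), le_rfl⟩ = ∑ j, if h : i = j then f ⟨(i, j), h.le⟩ else 0 := by
    rw [Finset.sum_eq_single i] <;> simp +contextual [eq_comm]
  rw [h2, ← Finset.sum_add_distrib]
  refine Finset.sum_congr rfl fun j _ => ?_
  rcases lt_trichotomy i j with h | h | h
  · simp [h.le, h, h.ne]
  · simp [h]
  · simp [not_le.mpr h, not_lt.mpr h.le, h.ne']

theorem sum_weights_eq (w : Position n → ℤ) :
    ∑ p, ((n : ℤ) - 2 * p.deg) * w p = (n : ℤ) * ∑ i : Fin n, w ⟨(i, i), le_rfl⟩ +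
      ∑ i, ∑ j, ∑ l, if h : i < j ∧ j < l then
        w ⟨(i, j), h.1.le⟩ + w ⟨(j, l), h.2.le⟩ - w ⟨(i, l), (h.1.trans h.2).le⟩ else 0 := by
  have ht := sum_triples (n := n) (fun i j => if h : i ≤ j then w ⟨(i, j), h⟩ else 0)
  rw [sum_position_eq, Finset.mul_sum]
  congr 1
  · simp [Position.deg]
  · convert ht.symm using 5 with i _ j _ i _ j _ l
    · split_ifs with h h'
      · rfl
      · exact absurd h.le h'
      · rfl
    · split_ifs with h <;> first | rfl | omega

theorem mul_sum_weights_le {G : AlgFiltration k (upperTriangularAlg k n)} {w : Position n → ℤ}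
    (hw : G.IsLeadingWeight (coords k n) Position.key w) :
    (n : ℝ) * ∑ p, (w p : ℝ) ≤ 2 * ∑ p, (p.deg : ℝ) * (w p : ℝ) := by
  have h : ∑ p, ((n : ℤ) - 2 * p.deg) * w p ≤ 0 := by
    rw [sum_weights_eq]
    have h1 : ∑ i : Fin n, w ⟨(i, i), le_rfl⟩ ≤ 0 :=
      Finset.sum_nonpos fun i _ => weight_diag_nonpos hw _ rfl
    have h2 : ∑ i, ∑ j, ∑ l, (if h : i < j ∧ j < l then
        w ⟨(i, j), h.1.le⟩ + w ⟨(j, l), h.2.le⟩ - w ⟨(i, l), (h.1.trans h.2).le⟩ else 0) ≤ 0 := by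
      refine Finset.sum_nonpos fun i _ => Finset.sum_nonpos fun j _ =>
        Finset.sum_nonpos fun l _ => ?_
      split_ifs with h
      · have := weight_add_le hw h.1.le h.2.le
        omega
      · rfl
    have h3 : (n : ℤ) * ∑ i : Fin n, w ⟨(i, i), le_rfl⟩ ≤ 0 :=
      mul_nonpos_of_nonneg_of_nonpos (by positivity) h1
    omega
  have h' : ∑ p, ((n : ℝ) - 2 * (p.deg : ℝ)) * (w p : ℝ) ≤ 0 := by exact_mod_cast h
  simp only [sub_mul, Finset.sum_sub_distrib, mul_assoc, ← Finset.mul_sum] at h'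
  linarith

/-- The degree is additive along i < j < l and zero on the diagonal, so every term discarded in the
inequality vanishes. -/
theorem mul_sum_deg_eq (n : ℕ) :
    (n : ℝ) * ∑ p : Position n, (p.deg : ℝ) = 2 * ∑ p : Position n, (p.deg : ℝ) ^ 2 := by
  have h : ∑ p : Position n, ((n : ℤ) - 2 * p.deg) * p.deg = 0 := by
    rw [sum_weights_eq]
    simp [Position.deg]
  have h' : ∑ p : Position n, ((n : ℝ) - 2 * (p.deg : ℝ)) * (p.deg : ℝ) = 0 := by
    exact_mod_cast h
  simp only [sub_mul, Finset.sum_sub_distrib, mul_assoc, ← Finset.mul_sum] at h'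
  simp only [pow_two]
  linarith

end Sums

/-! ### Semistability for n ≤ 1, instability for n ≥ 2 -/

theorem Position.deg_eq_zero_of_le_one (hn : n ≤ 1) (p : Position n) : p.deg = 0 := by
  have h1 := p.1.1.2
  have h2 := p.1.2.2
  unfold Position.deg
  omega

theorem exists_deg_eq_one (hn : 2 ≤ n) : ∃ p : Position n, p.deg = 1 :=
  ⟨⟨(⟨0, by omega⟩, ⟨1, by omega⟩), by simp [Fin.le_def]⟩, by simp [Position.deg]⟩

theorem sum_deg_sq_pos (hn : 2 ≤ n) : 0 < ∑ p : Position n, (p.deg : ℝ) ^ 2 := by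
  obtain ⟨p, hp⟩ := exists_deg_eq_one hn
  exact Finset.sum_pos' (fun _ _ => sq_nonneg _) ⟨p, Finset.mem_univ p, by simp [hp]⟩

theorem wt_degFiltration : (degFiltration k n).wt = ∑ p : Position n, (p.deg : ℝ) :=
  isLeadingWeight_degFiltration.wt_eq (coords_injective k n) (Position.key_injective n)

theorem norm_degFiltration :
    (degFiltration k n).norm = Real.sqrt (∑ p : Position n, (p.deg : ℝ) ^ 2) :=
  isLeadingWeight_degFiltration.norm_eq (coords_injective k n) (Position.key_injective n)

theorem wt_degFiltration_pos (hn : 2 ≤ n) : 0 < (degFiltration k n).wt := by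
  have h1 := mul_sum_deg_eq n
  have h2 := sum_deg_sq_pos hn
  rw [wt_degFiltration]
  have h3 : (0 : ℝ) < n := by exact_mod_cast (by omega : 0 < n)
  by_contra h
  nlinarith

theorem isSemistableAlg_of_le_one (hn : n ≤ 1) : IsSemistableAlg k (upperTriangularAlg k n) := by
  intro G
  obtain ⟨w, hw⟩ := exists_isLeadingWeight (coords_surjective k n) Position.key G
  rw [hw.wt_eq (coords_injective k n) (Position.key_injective n), neg_nonneg]
  refine Finset.sum_nonpos fun p _ => ?_
  have hp := p.deg_eq_zero_of_le_one hn
  exact_mod_cast weight_diag_nonpos hw p (Fin.ext (by unfold Position.deg at hp; omega))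

theorem degFiltration_eq_trivial (hn : n ≤ 1) :
    degFiltration k n = AlgFiltration.trivial k (upperTriangularAlg k n) := by
  apply AlgFiltration.ext_F
  intro m
  ext x
  rw [mem_degFiltration_iff]
  by_cases hm : m ≤ 0
  · simp only [AlgFiltration.trivial, hm, if_true, Submodule.mem_top, iff_true]
    intro p hp
    rw [p.deg_eq_zero_of_le_one hn] at hp
    omega
  · simp only [AlgFiltration.trivial, hm, if_false, Submodule.mem_bot]
    constructor
    · intro h
      apply coords_injective
      ext p
      rw [h p (by rw [p.deg_eq_zero_of_le_one hn]; omega), map_zero, Pi.zero_apply]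
    · rintro rfl p _
      simp

theorem degFiltration_ne_trivial (hn : 2 ≤ n) :
    degFiltration k n ≠ AlgFiltration.trivial k (upperTriangularAlg k n) := by
  intro h
  obtain ⟨p, hp⟩ := exists_deg_eq_one hn
  obtain ⟨x, hx, hne, _⟩ := (isLeadingWeight_degFiltration (k := k) p 1).mpr hp.ge
  rw [h] at hx
  have : x = 0 := by simpa [AlgFiltration.trivial] using hx
  simp [this] at hne

/-! ### Optimality and uniqueness -/

/-- The minimal value of the numerical invariant is attained, and where it is attained the leading
weights are proportional to the degrees. -/
theorem nu_degFiltration_le (hn : 2 ≤ n) {H : AlgFiltration k (upperTriangularAlg k n)}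
    {w : Position n → ℤ} (hw : H.IsLeadingWeight (coords k n) Position.key w) :
    (degFiltration k n).nu ≤ H.nu ∧ (H.nu ≤ (degFiltration k n).nu →
      ∃ c : ℝ, 0 < c ∧ ∀ p, (w p : ℝ) = c * (p.deg : ℝ)) := by
  have hn0 : (0 : ℝ) < n := by exact_mod_cast (by omega : 0 < n)
  have hwt := mul_sum_weights_le hw
  have hdeg := mul_sum_deg_eq n
  have hTpos := sum_deg_sq_pos hn
  have hUpos : 0 < ∑ p : Position n, (p.deg : ℝ) := by
    rw [← wt_degFiltration (k := k)]
    exact wt_degFiltration_pos hn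
  have hCS := Finset.sum_mul_sq_le_sq_mul_sq Finset.univ
    (fun p : Position n => (p.deg : ℝ)) (fun p => (w p : ℝ))
  have hexp : ∀ c : ℝ, ∑ p, ((w p : ℝ) - c * (p.deg : ℝ)) ^ 2 = ∑ p, (w p : ℝ) ^ 2 -
      2 * c * ∑ p, (p.deg : ℝ) * (w p : ℝ) + c ^ 2 * ∑ p : Position n, (p.deg : ℝ) ^ 2 := by
    intro c
    simp only [Finset.mul_sum, ← Finset.sum_sub_distrib, ← Finset.sum_add_distrib]
    exact Finset.sum_congr rfl fun p _ => by ring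
  have hS2 : 0 ≤ ∑ p, (w p : ℝ) ^ 2 := Finset.sum_nonneg fun _ _ => sq_nonneg _
  unfold nu
  rw [hw.wt_eq (coords_injective k n) (Position.key_injective n),
    hw.norm_eq (coords_injective k n) (Position.key_injective n),
    wt_degFiltration, norm_degFiltration]
  set S := ∑ p, (w p : ℝ)
  set Q := ∑ p, (w p : ℝ) ^ 2
  set D := ∑ p, (p.deg : ℝ) * (w p : ℝ)
  set T := ∑ p : Position n, (p.deg : ℝ) ^ 2
  set U := ∑ p : Position n, (p.deg : ℝ)
  have hrT : 0 < √T := Real.sqrt_pos.mpr hTpos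
  have hTT : √T * √T = T := Real.mul_self_sqrt hTpos.le
  -- When the norm of H is zero, `nu` takes the default value 0, which still exceeds the negative
  -- value at the degree filtration.
  rcases hS2.eq_or_lt with hQ | hQ
  · have : -U / √T < 0 := div_neg_of_neg_of_pos (by linarith) hrT
    rw [← hQ, Real.sqrt_zero, div_zero]
    exact ⟨this.le, fun h => absurd h (not_le.mpr this)⟩
  have hrQ : 0 < √Q := Real.sqrt_pos.mpr hQ
  have hQQ : √Q * √Q = Q := Real.mul_self_sqrt hQ.le
  have hD : D ≤ √T * √Q := by
    rw [← Real.sqrt_mul hTpos.le]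
    exact Real.le_sqrt_of_sq_le hCS
  have hUT : n * (U / √T) = 2 * √T := by
    field_simp
    nlinarith
  rw [neg_div, neg_div, neg_le_neg_iff, neg_le_neg_iff]
  constructor
  · rw [div_le_iff₀ hrQ]
    refine le_of_mul_le_mul_left ?_ hn0
    calc n * S ≤ 2 * D := hwt
      _ ≤ 2 * √T * √Q := by linarith
      _ = n * (U / √T * √Q) := by rw [← hUT]; ring
  · intro h
    rw [le_div_iff₀ hrQ] at h
    have h1 : √T * √Q ≤ D := by
      have := mul_le_mul_of_nonneg_left h hn0.le
      rw [← mul_assoc, hUT] at this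
      linarith
    have hDeq : D = √T * √Q := le_antisymm hD h1
    -- Equality in Cauchy–Schwarz makes c the ratio of the norms: ‖w - c · deg‖² expands to Q - 2Q +
    -- Q = 0.
    refine ⟨√Q / √T, div_pos hrQ hrT, fun p => ?_⟩
    have hzero : ∑ p, ((w p : ℝ) - √Q / √T * (p.deg : ℝ)) ^ 2 = 0 := by
      rw [hexp, hDeq, div_pow, Real.sq_sqrt hQ.le, Real.sq_sqrt hTpos.le]
      field_simp
      rw [Real.sq_sqrt hQ.le]
      ring
    have := (Finset.sum_eq_zero_iff_of_nonneg fun _ _ => sq_nonneg _).mp hzero p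
      (Finset.mem_univ p)
    exact sub_eq_zero.mp (pow_eq_zero_iff two_ne_zero |>.mp this)

/-- Degree is compared first in the order, so the weight of the leading position bounds the degrees
of all nonzero entries. This gives one inclusion, and the dimensions agree. -/
theorem isMultiple_of_weight_eq {H : AlgFiltration k (upperTriangularAlg k n)} {c : ℕ} (hc : 0 < c)
    (hw : H.IsLeadingWeight (coords k n) Position.key fun p => c * p.deg) :
    IsMultiple c H (degFiltration k n) := by
  intro m
  have hA : FiniteDimensional k (upperTriangularAlg k n) :=
    FiniteDimensional.of_injective _ (coords_injective k n)
  have hceil : ∀ p : Position n, ⌈(m : ℚ) / (c : ℚ)⌉ ≤ p.deg ↔ m ≤ c * p.deg := by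
    intro p
    have hc' : (0 : ℚ) < c := by exact_mod_cast hc
    rw [Int.ceil_le, div_le_iff₀ hc', mul_comm]
    exact_mod_cast Iff.rfl
  apply Submodule.eq_of_le_of_finrank_eq
  · intro x hx
    rw [mem_degFiltration_iff]
    intro q hq
    by_cases hx0 : x = 0
    · simp [hx0]
    obtain ⟨p, hp, hp0⟩ :=
      Submodule.exists_leading_position (coords_injective k n) Position.key hx0
    have h1 := (hceil p).mpr ((hw p m).mp ⟨x, hx, hp, hp0⟩)
    exact hp0 q (Position.key_lt_iff.mpr (Or.inl (by omega)))
  · rw [hw.finrank_eq (coords_injective k n) (Position.key_injective n),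
      isLeadingWeight_degFiltration.finrank_eq (coords_injective k n) (Position.key_injective n)]
    simp only [hceil]

end UpperTriangular

open UpperTriangular in
theorem mainTheorem10 (k : Type*) [Field k] [PerfectField k] (n : ℕ) :
    IsCanonicalFiltration
      (splitFiltration (matrixUnitGrading k n) (matrixUnitGrading_isAlgGrading k n)) := by
  constructor
  · intro hss
    by_cases hn : n ≤ 1
    · exact degFiltration_eq_trivial hn
    · have h1 := hss (degFiltration k n)
      have h2 := wt_degFiltration_pos (k := k) (n := n) (by omega)
      linarith
  · intro hss
    have hn : 2 ≤ n := by
      by_contra h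
      exact hss (isSemistableAlg_of_le_one (by omega))
    refine ⟨⟨degFiltration_ne_trivial hn, fun H _ => ?_⟩, fun H hH => ?_⟩
    · obtain ⟨w, hw⟩ := AlgFiltration.exists_isLeadingWeight (coords_surjective k n) Position.key H
      exact (nu_degFiltration_le hn hw).1
    · obtain ⟨w, hw⟩ := AlgFiltration.exists_isLeadingWeight (coords_surjective k n) Position.key H
      obtain ⟨c, hc, hwc⟩ := (nu_degFiltration_le hn hw).2
        (hH.2 _ (degFiltration_ne_trivial hn))
      -- At a position of degree 1 the real ratio c equals a weight, hence is an integer.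
      obtain ⟨p, hp⟩ := exists_deg_eq_one hn
      have hcp : (w p : ℝ) = c := by simpa [hp] using hwc p
      have hpos : 0 < w p := by
        rw [← hcp] at hc
        exact_mod_cast hc
      refine ⟨(w p).toNat, by omega, isMultiple_of_weight_eq (by omega) ?_⟩
      convert hw using 1
      ext q
      rw [Int.toNat_of_nonneg hpos.le]
      have := hwc q
      rw [← hcp] at this
      exact_mod_cast this.symm
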